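/- Let $f:\mathbb{C}\to\widehat{\mathbb{C}}=\mathbb{C}\cup\{\infty\}$ be a transcendental (i.e. non-rational) meromorphic function. Call $b\in\mathbb{C}$ a Baker omitted value (bov) of $f$ if $f(z)\neq b$ for all $z\in\mathbb{C}$ and there is $r_0>0$ such that for every $0<r<r_0$ each connected component of the boundary (in $\mathbb{C}$) of $f^{-1}(\{w\in\mathbb{C}:|w-b|<r\})$ is bounded. A critical point of $f$ is a zero of $f'$ or a multiple pole, a critical value is the image in $\widehat{\mathbb{C}}$ of a critical point, and $a\in\widehat{\mathbb{C}}$ is an asymptotic value if $f(\gamma(t))\to a$ as $t\to\infty$ for some curve $\gamma:[0,\infty)\to\mathbb{C}$ with $\gamma(t)\to\infty$; the set of singular values is the closure in $\widehat{\mathbb{C}}$ of the set of all critical and asymptotic values. If $b$ is a bov of $f$, then $b$ is a limit point (accumulation point) of the set of critical values of $f$. In particular, $f$ has infinitely many singular values. -/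

import Mathlib

open Filter Topology Set
open scoped Polynomial

noncomputable section

namespace BakerOmitted

/-- The map `ℂ → ℂ ∪ {∞}` given by a meromorphic function in normal form: poles are sent to `∞`,
and at every other point `f` is analytic and keeps its value. -/
def toSphere (f : ℂ → ℂ) (z : ℂ) : OnePoint ℂ :=
  open Classical in
  if meromorphicOrderAt f z < 0 then OnePoint.infty else ((f z : ℂ) : OnePoint ℂ)

/-- `f` is a quotient of two polynomials (away from the zeros of the denominator). -/
def IsRational (f : ℂ → ℂ) : Prop :=
  ∃ p q : ℂ[X], q ≠ 0 ∧ ∀ z : ℂ, q.eval z ≠ 0 → f z = p.eval z / q.eval z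

/-- Transcendental meromorphic functions on the plane. Normal form removes the arbitrariness
of the values at isolated points. -/
structure IsTranscendentalMeromorphic (f : ℂ → ℂ) : Prop where
  meromorphic : MeromorphicNFOn f univ
  not_rational : ¬ IsRational f

/-- `b` is not attained by `f : ℂ → ℂ ∪ {∞}`. -/
def IsOmittedValue (f : ℂ → ℂ) (b : ℂ) : Prop :=
  ∀ z : ℂ, toSphere f z ≠ (b : OnePoint ℂ)

/-- The preimage in the plane, under `f : ℂ → ℂ ∪ {∞}`, of the disk of radius `r` about `b`. -/
def preimageDisk (f : ℂ → ℂ) (b : ℂ) (r : ℝ) : Set ℂ :=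
  toSphere f ⁻¹' ((fun w : ℂ => (w : OnePoint ℂ)) '' Metric.ball b r)

/-- Baker omitted value: an omitted value `b` such that, for every sufficiently small disk `D`
about `b`, each connected component of the boundary of `f⁻¹(D)` in the plane is bounded. -/
def IsBov (f : ℂ → ℂ) (b : ℂ) : Prop :=
  IsOmittedValue f b ∧
    ∃ r₀ : ℝ, 0 < r₀ ∧ ∀ r : ℝ, 0 < r → r < r₀ →
      ∀ z ∈ frontier (preimageDisk f b r),
        Bornology.IsBounded (connectedComponentIn (frontier (preimageDisk f b r)) z)

/-- Critical points: zeros of the derivative and multiple poles. -/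
def criticalPoints (f : ℂ → ℂ) : Set ℂ :=
  {z | (0 ≤ meromorphicOrderAt f z ∧ deriv f z = 0) ∨
    meromorphicOrderAt f z ≤ ((-2 : ℤ) : WithTop ℤ)}

/-- Critical values, in the sphere. -/
def criticalValues (f : ℂ → ℂ) : Set (OnePoint ℂ) :=
  toSphere f '' criticalPoints f

/-- Asymptotic values, in the sphere: limits of `f` along curves tending to `∞`. -/
def asymptoticValues (f : ℂ → ℂ) : Set (OnePoint ℂ) :=
  {a | ∃ γ : ℝ → ℂ, ContinuousOn γ (Ici 0) ∧ Tendsto γ atTop (Bornology.cobounded ℂ) ∧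
    Tendsto (fun t => toSphere f (γ t)) atTop (𝓝 a)}

/-- Singular values: the closure, in the sphere, of the critical and asymptotic values. -/
def singularValues (f : ℂ → ℂ) : Set (OnePoint ℂ) :=
  closure (criticalValues f ∪ asymptoticValues f)

end BakerOmitted

end

namespace BakerOmitted

/-! Since `b` is omitted, `g = 1 / (f - b)` extends to an entire function, and the preimage of the
disk of radius `r` about `b` is `{|g| > 1/r}`, with boundary `{|g| = 1/r}`. So for a bov all
components of high level curves of `|g|` are bounded. Zeros of `g'` off the zeros of `g` are
critical points of `f`, so it suffices to find them with `|g|` arbitrarily large.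

Suppose there are none above some level. Components of superlevel sets are unbounded by the maximum
principle, so the planar separation result `isBounded_component_sublevel_or_superlevel` makes
components of high sublevel sets bounded. Two such components could only merge at a higher level
through a critical point (`mem_component_sublevel_of_no_critical`), so a high sublevel set is
connected, hence bounded. Then `g` is bounded away from zero near infinity, so it is rational by
Liouville (`exists_polynomials_of_isBounded_sublevel`), and so is `f`, a contradiction. -/

/-! ### Plane topology -/

/-- A bounded connected component of a closed set can be cut off by a bounded open set whose
frontier misses the closed set. -/
theorem exists_isOpen_frontier_disjoint {X : Type*} [MetricSpace X] [ProperSpace X] {L O : Set X}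
    {z : X} (hL : IsClosed L) (hz : z ∈ L) (hb : Bornology.IsBounded (connectedComponentIn L z))
    (hO : IsOpen O) (hLO : connectedComponentIn L z ⊆ O) :
    ∃ N : Set X, IsOpen N ∧ Bornology.IsBounded N ∧ z ∈ N ∧ N ⊆ O ∧ Disjoint (frontier N) L := by
  obtain ⟨ρ, hρ⟩ := hb.subset_ball z
  set T : Set X := L ∩ Metric.closedBall z ρ with hT
  have hTc : IsCompact T := (isCompact_closedBall z ρ).inter_left hL
  have hzρ : z ∈ Metric.ball z ρ := hρ (mem_connectedComponentIn hz)
  have hzT : z ∈ T := ⟨hz, Metric.ball_subset_closedBall hzρ⟩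
  have : CompactSpace T := isCompact_iff_compactSpace.1 hTc
  let z' : T := ⟨z, hzT⟩
  -- In a compact Hausdorff space a component is the intersection of the clopen sets around it, so
  -- by compactness a single clopen `Q` already lies in the given neighbourhood.
  have hU : ∀ x ∈ ⋂ s : { s : Set T // IsClopen s ∧ z' ∈ s }, (s : Set T),
      ((↑) : T → X) ⁻¹' (O ∩ Metric.ball z ρ) ∈ 𝓝 x := by
    intro x hx
    rw [← connectedComponent_eq_iInter_isClopen] at hx
    have hx' : (x : X) ∈ connectedComponentIn L z := by
      have h1 : (x : X) ∈ connectedComponentIn T z := by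
        rw [connectedComponentIn_eq_image hzT]
        exact ⟨x, hx, rfl⟩
      exact connectedComponentIn_mono z inter_subset_left h1
    exact ((hO.inter Metric.isOpen_ball).preimage continuous_subtype_val).mem_nhds
      ⟨hLO hx', hρ hx'⟩
  have : Nonempty { s : Set T // IsClopen s ∧ z' ∈ s } := ⟨⟨univ, isClopen_univ, mem_univ _⟩⟩
  obtain ⟨⟨Q, hQ, hzQ⟩, hQU⟩ := exists_subset_nhds_of_compactSpace
    (V := fun s : { s : Set T // IsClopen s ∧ z' ∈ s } => (s : Set T))
    (fun s t => ⟨⟨s ∩ t, s.2.1.inter t.2.1, s.2.2, t.2.2⟩, inter_subset_left, inter_subset_right⟩)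
    (fun s => s.2.1.1) hU
  have hC1 : IsCompact (((↑) : T → X) '' Q) := hQ.1.isCompact.image continuous_subtype_val
  have hC2 : IsCompact (((↑) : T → X) '' Qᶜ) :=
    hQ.compl.1.isCompact.image continuous_subtype_val
  have hdisj : Disjoint (((↑) : T → X) '' Q) (((↑) : T → X) '' Qᶜ) :=
    (disjoint_image_iff Subtype.val_injective).2 disjoint_compl_right
  obtain ⟨N₁, N₂, hN₁, hN₂, h1, h2, h12⟩ := SeparatedNhds.of_isCompact_isCompact hC1 hC2 hdisj
  have hNo : IsOpen (N₁ ∩ (O ∩ Metric.ball z ρ)) := hN₁.inter (hO.inter Metric.isOpen_ball)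
  refine ⟨N₁ ∩ (O ∩ Metric.ball z ρ), hNo,
    Metric.isBounded_ball.subset (inter_subset_right.trans inter_subset_right),
    ⟨h1 ⟨z', hzQ, rfl⟩, hLO (mem_connectedComponentIn hz), hzρ⟩,
    inter_subset_right.trans inter_subset_left, ?_⟩
  rw [Set.disjoint_left]
  intro x hx hxL
  rw [hNo.frontier_eq] at hx
  have hxT : x ∈ T := ⟨hxL, Metric.closure_ball_subset_closedBall
    (closure_mono (inter_subset_right.trans inter_subset_right) hx.1)⟩
  by_cases hxQ : (⟨x, hxT⟩ : T) ∈ Q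
  · exact hx.2 ⟨h1 ⟨_, hxQ, rfl⟩, hQU hxQ⟩
  · have hx2 : x ∈ N₂ := h2 ⟨_, hxQ, rfl⟩
    obtain ⟨y, hy2, hy1, -⟩ := mem_closure_iff.1 hx.1 N₂ hN₂ hx2
    exact Set.disjoint_left.1 h12 hy1 hy2

/-- The set is the image of a closed half-plane under `exp`. -/
theorem isPreconnected_compl_ball {ρ : ℝ} (hρ : 0 < ρ) :
    IsPreconnected (Metric.ball (0 : ℂ) ρ)ᶜ := by
  have h : (Metric.ball (0 : ℂ) ρ)ᶜ = Complex.exp '' {w : ℂ | Real.log ρ ≤ w.re} := by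
    ext z
    simp only [mem_compl_iff, Metric.mem_ball, dist_zero_right, not_lt, mem_image, mem_ofPred_eq]
    constructor
    · intro hz
      have hz0 : z ≠ 0 := norm_pos_iff.1 (hρ.trans_le hz)
      exact ⟨Complex.log z, by rw [Complex.log_re]; exact Real.log_le_log hρ hz,
        Complex.exp_log hz0⟩
    · rintro ⟨w, hw, rfl⟩
      rw [Complex.norm_exp]
      exact (Real.log_le_iff_le_exp hρ).1 hw
  rw [h]
  exact (convex_halfSpace_re_ge _).isPreconnected.image _ Complex.continuous_exp.continuousOn

/-- `F` is integer-valued on `s`, and the integers are discrete in `ℝ`. -/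
theorem eqOn_of_coe_unitAddCircle_eq_zero {X : Type*} [TopologicalSpace X] {s : Set X}
    (hs : IsPreconnected s) {F : X → ℝ} (hF : ContinuousOn F s)
    (h : ∀ x ∈ s, (F x : UnitAddCircle) = 0) {x y : X} (hx : x ∈ s) (hy : y ∈ s) : F x = F y := by
  refine hs.constant_of_mapsTo (T := (AddSubgroup.zmultiples (1 : ℝ) : Set ℝ))
    ⟨inferInstanceAs (DiscreteTopology (AddSubgroup.zmultiples (1 : ℝ)))⟩ hF ?_ hx hy
  intro x hx
  exact (QuotientAddGroup.eq_zero_iff _).1 (h x hx)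

/-- In the plane, if the component of `z` in a level set of a continuous function is bounded, then
its component in the sublevel set or the one in the superlevel set is bounded. -/
theorem isBounded_component_sublevel_or_superlevel {u : ℂ → ℝ} (hu : Continuous u) {z : ℂ} {c : ℝ}
    (hz : u z = c) (hb : Bornology.IsBounded (connectedComponentIn {x | u x = c} z)) :
    Bornology.IsBounded (connectedComponentIn {x | u x ≤ c} z) ∨
      Bornology.IsBounded (connectedComponentIn {x | c ≤ u x} z) := by
  classical
  by_contra! hcon
  obtain ⟨N, hNo, hNb, hzN, -, hNL⟩ := exists_isOpen_frontier_disjoint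
    (isClosed_eq hu continuous_const) hz hb isOpen_univ (subset_univ _)
  obtain ⟨m, hcm, hm⟩ : ∃ m, c < m ∧ ∀ x ∈ frontier N ∩ {x | c ≤ u x}, m ≤ u x := by
    have hcpt : IsCompact (frontier N ∩ {x | c ≤ u x}) :=
      (hNb.isCompact_closure.of_isClosed_subset isClosed_frontier
        frontier_subset_closure).inter_right (isClosed_le continuous_const hu)
    refine hcpt.exists_forall_le' hu.continuousOn fun x hx => lt_of_le_of_ne hx.2 fun h => ?_
    exact Set.disjoint_left.1 hNL hx.1 h.symm
  -- On `frontier N` the cutoff only takes the values 0 and 1, which agree in the circle. So `χ` on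
  -- `N` and 0 outside glue to a continuous circle-valued map, which lifts to a real function `F`
  -- because the plane is simply connected.
  set χ : ℂ → ℝ := fun x => max 0 (min 1 ((u x - c) / (m - c))) with hχ
  have hχc : Continuous χ := by fun_prop
  have hχ0 : ∀ x, u x ≤ c → χ x = 0 := fun x hx => by
    have : (u x - c) / (m - c) ≤ 0 := div_nonpos_of_nonpos_of_nonneg (by linarith) (by linarith)
    exact max_eq_left ((min_le_right _ _).trans this)
  have hχ1 : ∀ x, m ≤ u x → χ x = 1 := fun x hx => by
    have : 1 ≤ (u x - c) / (m - c) := (one_le_div (by linarith)).2 (by linarith)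
    simp only [hχ]
    rw [min_eq_left this, max_eq_right zero_le_one]
  have hone : ((1 : ℝ) : UnitAddCircle) = 0 := AddCircle.coe_period 1
  have hfr : ∀ x ∈ frontier N, ((χ x : ℝ) : UnitAddCircle) = 0 := by
    intro x hx
    rcases le_total (u x) c with h | h
    · rw [hχ0 x h]; rfl
    · rw [hχ1 x (hm x ⟨hx, h⟩), hone]
  let h : C(ℂ, UnitAddCircle) := ⟨fun x => if x ∈ N then ((χ x : ℝ) : UnitAddCircle) else 0,
    Continuous.if hfr ((AddCircle.continuous_mk' 1).comp hχc) continuous_const⟩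
  obtain ⟨e₀, he₀⟩ := QuotientAddGroup.mk_surjective (h 0)
  obtain ⟨F, ⟨-, hF⟩, -⟩ := (AddCircle.isCoveringMap_coe (1 : ℝ)).existsUnique_continuousMap_lifts
    h 0 e₀ he₀
  have hF' : ∀ x, ((F x : ℝ) : UnitAddCircle) = if x ∈ N then ((χ x : ℝ) : UnitAddCircle) else 0 :=
    fun x => congrFun hF x
  obtain ⟨ρ, hρ, hNρ⟩ := hNb.subset_ball_lt 0 (0 : ℂ)
  have hfar : ∀ s : Set ℂ, ¬ Bornology.IsBounded s → ∃ x ∈ s, x ∈ (Metric.ball (0 : ℂ) ρ)ᶜ := by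
    intro s hs
    by_contra! hcon
    exact hs (Metric.isBounded_ball.subset fun x hx => not_not.1 (hcon x hx))
  -- If both components are unbounded, they can be followed from `z` to points `k`, `l` far out. `F`
  -- does not change along the sublevel component, rises by 1 along the superlevel one, and is
  -- constant near infinity: a contradiction.
  obtain ⟨k, hk, hkρ⟩ := hfar _ hcon.1
  obtain ⟨l, hl, hlρ⟩ := hfar _ hcon.2
  have hkl : F k = F l := by
    refine eqOn_of_coe_unitAddCircle_eq_zero (isPreconnected_compl_ball hρ)
      F.continuous.continuousOn (fun x hx => ?_) hkρ hlρ
    rw [hF', if_neg fun hxN => hx (hNρ hxN)]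
  have hzk : F z = F k := by
    refine eqOn_of_coe_unitAddCircle_eq_zero isPreconnected_connectedComponentIn
      F.continuous.continuousOn (fun x hx => ?_) (mem_connectedComponentIn hz.le) hk
    have hxc : x ∈ {x | u x ≤ c} := connectedComponentIn_subset _ _ hx
    rw [hF', hχ0 x hxc]
    simp
  have hzl : F z - N.piecewise χ (fun _ => 1) z = F l - N.piecewise χ (fun _ => 1) l := by
    refine eqOn_of_coe_unitAddCircle_eq_zero
      (F := fun x => F x - N.piecewise χ (fun _ => 1) x) isPreconnected_connectedComponentIn
      (F.continuous.continuousOn.sub ?_) (fun x hx => ?_) (mem_connectedComponentIn hz.ge) hl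
    · refine ContinuousOn.piecewise (fun x hx => ?_) hχc.continuousOn continuousOn_const
      exact hχ1 x (hm x ⟨hx.2, connectedComponentIn_subset _ _ hx.1⟩)
    · rw [AddCircle.coe_sub, hF']
      by_cases hxN : x ∈ N
      · simp [hxN]
      · simp [hxN, hone]
  rw [piecewise_eq_of_mem _ _ _ hzN, hχ0 z hz.le,
    piecewise_eq_of_notMem _ _ _ fun hlN => hlρ (hNρ hlN)] at hzl
  linarith

/-- A dense subset of a preconnected set which is locally preconnected at every point of the
larger set is preconnected. -/
theorem isPreconnected_of_subset_closure {X : Type*} [TopologicalSpace X] {C O : Set X}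
    (hC : IsPreconnected C) (hOC : O ⊆ C) (hCO : C ⊆ closure O)
    (hloc : ∀ x ∈ C, ∃ N ∈ 𝓝 x, IsPreconnected (N ∩ O)) : IsPreconnected O := by
  rintro U V hU hV hUV ⟨a, haO, haU⟩ ⟨b, hbO, hbV⟩
  -- The closures of the two pieces cover `C`, so they meet at a point of `C`; near it the local
  -- hypothesis applies.
  obtain ⟨x, hxC, hxU, hxV⟩ := isPreconnected_closed_iff.1 hC (closure (O ∩ U)) (closure (O ∩ V))
    isClosed_closure isClosed_closure
    (by rw [← closure_union, ← inter_union_distrib_left, inter_eq_left.2 hUV]; exact hCO)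
    ⟨a, hOC haO, subset_closure ⟨haO, haU⟩⟩ ⟨b, hOC hbO, subset_closure ⟨hbO, hbV⟩⟩
  obtain ⟨N, hN, hNO⟩ := hloc x hxC
  obtain ⟨p, hpN, hpO, hpU⟩ := mem_closure_iff_nhds.1 hxU N hN
  obtain ⟨q, hqN, hqO, hqV⟩ := mem_closure_iff_nhds.1 hxV N hN
  obtain ⟨y, hy, hyUV⟩ := hNO U V hU hV (inter_subset_right.trans hUV) ⟨p, ⟨hpN, hpO⟩, hpU⟩
    ⟨q, ⟨hqN, hqO⟩, hqV⟩
  exact ⟨y, hy.2, hyUV⟩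

/-! ### Level sets of the modulus of an entire function -/

theorem isClosed_connectedComponentIn {X : Type*} [TopologicalSpace X] {s : Set X}
    (hs : IsClosed s) (x : X) : IsClosed (connectedComponentIn s x) := by
  by_cases hx : x ∈ s
  · refine isClosed_of_closure_subset (isPreconnected_connectedComponentIn.closure
      |>.subset_connectedComponentIn (subset_closure (mem_connectedComponentIn hx)) ?_)
    exact closure_minimal (connectedComponentIn_subset _ _) hs
  · rw [connectedComponentIn_eq_empty hx]
    exact isClosed_empty

/-- In the chart of the inverse function theorem, `N` becomes a ball, whose intersection with `S` is
convex. One `N` serves all `S`, here the open and the closed disk. -/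
theorem exists_nhds_isPreconnected_inter_preimage {g : ℂ → ℂ} {g' x : ℂ}
    (hg : HasStrictDerivAt g g' x) (hg' : g' ≠ 0) :
    ∃ N ∈ 𝓝 x, ∀ S : Set ℂ, Convex ℝ S → IsPreconnected (N ∩ g ⁻¹' S) := by
  have hs := hg.hasStrictFDerivAt_equiv hg'
  set e := hs.toOpenPartialHomeomorph g with he
  have hcoe : (e : ℂ → ℂ) = g := hs.toOpenPartialHomeomorph_coe
  have hx : x ∈ e.source := hs.mem_toOpenPartialHomeomorph_source
  have hgx : g x ∈ e.target := hs.image_mem_toOpenPartialHomeomorph_target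
  obtain ⟨ε, hε, hball⟩ := Metric.isOpen_iff.1 e.open_target (g x) hgx
  refine ⟨e.source ∩ g ⁻¹' Metric.ball (g x) ε, ?_, fun S hS => ?_⟩
  · exact inter_mem (e.open_source.mem_nhds hx)
      (hg.hasDerivAt.continuousAt.preimage_mem_nhds (Metric.ball_mem_nhds _ hε))
  · have hEq : e.source ∩ g ⁻¹' Metric.ball (g x) ε ∩ g ⁻¹' S =
        e.symm '' (Metric.ball (g x) ε ∩ S) := by
      rw [e.symm.image_eq_target_inter_inv_preimage (inter_subset_left.trans hball), e.symm_symm,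
        hcoe, e.symm_target, preimage_inter, inter_assoc]
    rw [hEq]
    exact (((convex_ball _ _).inter hS).isPreconnected).image _
      (e.symm.continuousOn.mono (inter_subset_left.trans hball))

section Entire

variable {g : ℂ → ℂ}

theorem isClosed_norm_le (hg : Differentiable ℂ g) (R : ℝ) : IsClosed {z | ‖g z‖ ≤ R} :=
  isClosed_le hg.continuous.norm continuous_const

theorem mem_nhds_connectedComponentIn_norm_le (hg : Differentiable ℂ g) {R : ℝ} {z x : ℂ}
    (hx : x ∈ connectedComponentIn {z | ‖g z‖ ≤ R} z) (hxR : ‖g x‖ < R) :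
    connectedComponentIn {z | ‖g z‖ ≤ R} z ∈ 𝓝 x := by
  obtain ⟨ε, hε, hball⟩ := Metric.isOpen_iff.1
    (isOpen_lt hg.continuous.norm (continuous_const (y := R))) x hxR
  rw [connectedComponentIn_eq hx]
  exact mem_of_superset (Metric.ball_mem_nhds x hε)
    ((convex_ball x ε).isPreconnected.subset_connectedComponentIn (Metric.mem_ball_self hε)
      fun y hy => (le_of_lt (hball hy) : ‖g y‖ ≤ R))

/-- Components of superlevel sets of the modulus of an entire function are unbounded. -/
theorem not_isBounded_component_superlevel (hg : Differentiable ℂ g) {R : ℝ} {z : ℂ}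
    (hz : R ≤ ‖g z‖) : ¬ Bornology.IsBounded (connectedComponentIn {x | R ≤ ‖g x‖} z) := by
  intro hb
  obtain ⟨N, -, hNb, hzN, -, hNL⟩ := exists_isOpen_frontier_disjoint
    (isClosed_le continuous_const hg.continuous.norm) hz hb isOpen_univ (subset_univ _)
  obtain ⟨w, hw, hmax⟩ := Complex.exists_mem_frontier_isMaxOn_norm hNb ⟨z, hzN⟩ hg.diffContOnCl
  exact Set.disjoint_left.1 hNL hw (hz.trans (hmax (subset_closure hzN)))

theorem isBounded_component_sublevel (hg : Differentiable ℂ g) (hnc : ¬ ∃ k, ∀ z, g z = k) {R : ℝ}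
    (hR : ∀ z, ‖g z‖ = R → Bornology.IsBounded (connectedComponentIn {x | ‖g x‖ = R} z)) (z : ℂ) :
    Bornology.IsBounded (connectedComponentIn {x | ‖g x‖ ≤ R} z) := by
  by_cases hz : ‖g z‖ ≤ R
  swap
  · rw [connectedComponentIn_eq_empty (F := {x | ‖g x‖ ≤ R}) hz]
    exact Bornology.isBounded_empty
  set K := connectedComponentIn {x | ‖g x‖ ≤ R} z with hK
  have hKsub : K ⊆ {x | ‖g x‖ ≤ R} := connectedComponentIn_subset _ _
  have hKu : K ≠ univ := by
    intro hu
    refine hnc (hg.exists_const_forall_eq_of_bounded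
      ((Metric.isBounded_closedBall (x := (0 : ℂ)) (r := R)).subset ?_))
    rintro _ ⟨x, rfl⟩
    have : x ∈ {x | ‖g x‖ ≤ R} := hKsub (hu ▸ mem_univ x)
    simpa using this
  -- By Liouville `K` is not the whole plane; a frontier point lies on the level curve, where the
  -- planar dichotomy can be applied.
  obtain ⟨x, hx⟩ := (nonempty_frontier_iff (s := K)).2
    ⟨⟨z, mem_connectedComponentIn hz⟩, hKu⟩
  have hxK : x ∈ K := (isClosed_connectedComponentIn (isClosed_norm_le hg R) z).frontier_subset hx
  have hxR : ‖g x‖ = R := by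
    refine le_antisymm (hKsub hxK) (not_lt.1 fun h => hx.2 ?_)
    exact mem_interior_iff_mem_nhds.2 (mem_nhds_connectedComponentIn_norm_le hg hxK h)
  rw [hK, connectedComponentIn_eq hxK]
  exact (isBounded_component_sublevel_or_superlevel hg.continuous.norm hxR (hR x hxR)).resolve_right
    (not_isBounded_component_superlevel hg hxR.ge)

/-- At a level without critical points, removing the level curve from a component of a sublevel set
does not disconnect it. -/
theorem isPreconnected_component_sublevel_inter_lt (hg : Differentiable ℂ g) {R : ℝ} (hR : 0 < R)
    (hcrit : ∀ x, ‖g x‖ = R → deriv g x ≠ 0) (z : ℂ) :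
    IsPreconnected (connectedComponentIn {x | ‖g x‖ ≤ R} z ∩ {x | ‖g x‖ < R}) := by
  set C := connectedComponentIn {x | ‖g x‖ ≤ R} z with hC
  have hCsub : ∀ x ∈ C, ‖g x‖ ≤ R := fun x hx =>
    (connectedComponentIn_subset _ _ hx : x ∈ {x | ‖g x‖ ≤ R})
  have hlt : g ⁻¹' Metric.ball 0 R = {x | ‖g x‖ < R} := by ext; simp
  have hle : g ⁻¹' Metric.closedBall 0 R = {x | ‖g x‖ ≤ R} := by ext; simp
  have key : ∀ x ∈ C, ‖g x‖ = R → ∃ N ∈ 𝓝 x, IsPreconnected (N ∩ {x | ‖g x‖ < R}) ∧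
      N ∩ {x | ‖g x‖ ≤ R} ⊆ C := by
    intro x hx hxR
    obtain ⟨N, hN, hNS⟩ := exists_nhds_isPreconnected_inter_preimage
      (hg.contDiff.contDiffAt.hasStrictDerivAt one_ne_zero) (hcrit x hxR)
    refine ⟨N, hN, hlt ▸ hNS _ (convex_ball _ _), ?_⟩
    rw [hC, connectedComponentIn_eq hx]
    exact (hle ▸ hNS _ (convex_closedBall _ _)).subset_connectedComponentIn
      ⟨mem_of_mem_nhds hN, hxR.le⟩ inter_subset_right
  refine isPreconnected_of_subset_closure isPreconnected_connectedComponentIn inter_subset_left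
    (fun x hx => ?_) (fun x hx => ?_)
  · rcases (hCsub x hx).lt_or_eq with h | h
    · exact subset_closure ⟨hx, h⟩
    · obtain ⟨N, hN, -, hNC⟩ := key x hx h
      have hmap : map g (𝓝 x) = 𝓝 (g x) :=
        (hg.contDiff.contDiffAt.hasStrictDerivAt one_ne_zero).map_nhds_eq (hcrit x h)
      have hcl : g x ∈ closure (Metric.ball (0 : ℂ) R) := by
        rw [closure_ball _ hR.ne']
        simpa using h.le
      have hfreq : ∃ᶠ w in map g (𝓝 x), w ∈ Metric.ball (0 : ℂ) R := by
        rw [hmap]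
        exact mem_closure_iff_frequently.1 hcl
      refine mem_closure_iff_frequently.2 (((frequently_map.1 hfreq).and_eventually hN).mono ?_)
      rintro y ⟨hy, hyN⟩
      have hy' : ‖g y‖ < R := by simpa using hy
      exact ⟨hNC ⟨hyN, hy'.le⟩, hy'⟩
  · rcases (hCsub x hx).lt_or_eq with h | h
    · have hnhds : C ∩ {x | ‖g x‖ < R} ∈ 𝓝 x :=
        inter_mem (mem_nhds_connectedComponentIn_norm_le hg hx h)
          ((isOpen_lt hg.continuous.norm continuous_const).mem_nhds h)
      obtain ⟨ε, hε, hball⟩ := Metric.mem_nhds_iff.1 hnhds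
      refine ⟨_, Metric.ball_mem_nhds x hε, ?_⟩
      rw [inter_eq_left.2 hball]
      exact (convex_ball x ε).isPreconnected
    · obtain ⟨N, hN, hNlt, hNC⟩ := key x hx h
      refine ⟨N, hN, ?_⟩
      have : N ∩ (C ∩ {x | ‖g x‖ < R}) = N ∩ {x | ‖g x‖ < R} := by
        ext y
        exact ⟨fun hy => ⟨hy.1, hy.2.2⟩,
          fun hy => ⟨hy.1, hNC ⟨hy.1, ofPred_subset_ofPred.2 (fun _ h => le_of_lt h) hy.2⟩, hy.2⟩⟩
      rwa [this]

/-- A mountain pass argument: if the components of the sublevel sets above level `M` are bounded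
and there are no critical points above level `M`, then the sublevel set at `M` is connected. -/
theorem mem_component_sublevel_of_no_critical (hg : Differentiable ℂ g) {M : ℝ} (hM : 0 ≤ M)
    (hb : ∀ R, M ≤ R → ∀ z, Bornology.IsBounded (connectedComponentIn {x | ‖g x‖ ≤ R} z))
    (hcrit : ∀ x, M < ‖g x‖ → deriv g x ≠ 0) {z w : ℂ} (hz : ‖g z‖ ≤ M) (hw : ‖g w‖ ≤ M) :
    w ∈ connectedComponentIn {x | ‖g x‖ ≤ M} z := by
  set S : Set ℝ := {R | M ≤ R ∧ w ∈ connectedComponentIn {x | ‖g x‖ ≤ R} z} with hS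
  have hSbdd : BddBelow S := ⟨M, fun R hR => hR.1⟩
  have mem_S : ∀ {P : Set ℂ} {R : ℝ}, IsPreconnected P → z ∈ P → w ∈ P → M ≤ R →
      (∀ x ∈ P, ‖g x‖ ≤ R) → R ∈ S := fun hPp hzP hwP hMR hPR =>
    ⟨hMR, hPp.subset_connectedComponentIn hzP hPR hwP⟩
  have hSne : S.Nonempty := by
    have hcpt : IsCompact (segment ℝ z w) := by
      rw [segment_eq_image_lineMap]
      exact isCompact_Icc.image AffineMap.lineMap_continuous
    obtain ⟨B, hB⟩ := hcpt.exists_bound_of_continuousOn hg.continuous.continuousOn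
    exact ⟨max M B, mem_S (convex_segment z w).isPreconnected (left_mem_segment _ _ _)
      (right_mem_segment _ _ _) (le_max_left _ _) fun x hx => (hB x hx).trans (le_max_right _ _)⟩
  set R := sInf S with hRdef
  have hMR : M ≤ R := le_csInf hSne fun r hr => hr.1
  -- The infimum is attained: otherwise a bounded `N` cuts the component off from `w`, and since
  -- `|g|` exceeds `R` by a fixed amount on `frontier N`, `N` still separates at slightly higher
  -- levels.
  have hwR : w ∈ connectedComponentIn {x | ‖g x‖ ≤ R} z := by
    by_contra hw'
    obtain ⟨N, hNo, hNb, hzN, hNw, hNL⟩ := exists_isOpen_frontier_disjoint (isClosed_norm_le hg R)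
      (hz.trans hMR : z ∈ {x | ‖g x‖ ≤ R}) (hb R hMR z) (O := {w}ᶜ) isOpen_compl_singleton
      (fun x hx hxw => hw' (hxw ▸ hx))
    have hcpt : IsCompact (frontier N) :=
      hNb.isCompact_closure.of_isClosed_subset isClosed_frontier frontier_subset_closure
    obtain ⟨a, hRa, ha⟩ := hcpt.exists_forall_le' (a := R) hg.continuous.norm.continuousOn
      fun x hx => not_le.1 fun h => Set.disjoint_left.1 hNL hx h
    obtain ⟨r, hr, hra⟩ := exists_lt_of_csInf_lt hSne hRa
    have hsub : connectedComponentIn {x | ‖g x‖ ≤ r} z ⊆ N := by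
      refine isPreconnected_connectedComponentIn.subset_of_closure_inter_subset hNo
        ⟨z, mem_connectedComponentIn (hz.trans hr.1), hzN⟩ fun x hx => not_not.1 fun hxN => ?_
      have hxr : x ∈ {x | ‖g x‖ ≤ r} := connectedComponentIn_subset _ _ hx.2
      exact absurd (ha x (hNo.frontier_eq ▸ ⟨hx.1, hxN⟩)) (not_le.2 (lt_of_le_of_lt hxr hra))
    exact hNw (hsub hr.2) rfl
  rcases hMR.eq_or_lt with h | h
  · rwa [h]
  exfalso
  -- If `R > M`, this open set is connected, so a path in it joins `z` to `w`; its maximum of `|g|`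
  -- is below `R`, against minimality.
  set O := connectedComponentIn {x | ‖g x‖ ≤ R} z ∩ {x | ‖g x‖ < R} with hOdef
  have hzO : z ∈ O := ⟨mem_connectedComponentIn (hz.trans hMR), hz.trans_lt h⟩
  have hwO : w ∈ O := ⟨hwR, hw.trans_lt h⟩
  have hOpen : IsOpen O := isOpen_iff_mem_nhds.2 fun x hx =>
    inter_mem (mem_nhds_connectedComponentIn_norm_le hg hx.1 hx.2)
      ((isOpen_lt hg.continuous.norm continuous_const).mem_nhds hx.2)
  have hOconn : IsConnected O := ⟨⟨z, hzO⟩, isPreconnected_component_sublevel_inter_lt hg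
    (hM.trans_lt h) (fun x hx => hcrit x (hx ▸ h)) z⟩
  obtain ⟨γ, hγ⟩ := (hOpen.isConnected_iff_isPathConnected.1 hOconn).joinedIn z hzO w hwO
  have hcpt : IsCompact (range γ) := isCompact_range γ.continuous
  obtain ⟨y, ⟨t, rfl⟩, hy⟩ := hcpt.exists_isMaxOn (range_nonempty γ)
    hg.continuous.norm.continuousOn
  have hlt : max M ‖g (γ t)‖ < R := max_lt h (hγ t).2
  refine absurd (csInf_le hSbdd (mem_S (isPreconnected_range γ.continuous) ⟨0, γ.source⟩
    ⟨1, γ.target⟩ (le_max_left M ‖g (γ t)‖) fun x hx => (hy hx).trans (le_max_right _ _)))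
    (not_le.2 hlt)

/-- If all components of high level sets of `|g|` are bounded and `g` has no critical points at high
levels, then some sublevel set of `|g|` is bounded. -/
theorem exists_isBounded_sublevel (hg : Differentiable ℂ g) (hnc : ¬ ∃ k, ∀ z, g z = k) {R₀ M : ℝ}
    (hR : ∀ R, R₀ < R → ∀ z, ‖g z‖ = R →
      Bornology.IsBounded (connectedComponentIn {x | ‖g x‖ = R} z))
    (hcrit : ∀ x, M < ‖g x‖ → deriv g x ≠ 0) :
    ∃ B, 0 < B ∧ Bornology.IsBounded {x | ‖g x‖ ≤ B} := by
  -- The `+ 1` gives levels strictly above `R₀`; the final 1 makes `B` positive.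
  set B := max M (max (R₀ + 1) 1) with hB
  have hB1 : 1 ≤ B := (le_max_right _ _).trans (le_max_right _ _)
  have hB2 : R₀ + 1 ≤ B := (le_max_left _ _).trans (le_max_right _ _)
  have hb : ∀ R, B ≤ R → ∀ z, Bornology.IsBounded (connectedComponentIn {x | ‖g x‖ ≤ R} z) :=
    fun R hBR => isBounded_component_sublevel hg hnc (hR R (by linarith))
  refine ⟨B, by linarith, ?_⟩
  rcases eq_empty_or_nonempty {x | ‖g x‖ ≤ B} with h | ⟨z, hz⟩
  · rw [h]; exact Bornology.isBounded_empty
  · exact (hb B le_rfl z).subset fun w hw => mem_component_sublevel_of_no_critical hg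
      (by linarith) hb (fun x hx => hcrit x ((le_max_left _ _).trans_lt hx)) hz hw

end Entire

/-! ### Entire functions bounded away from zero near infinity -/

theorem exists_bound_eval_le_one_add_norm_pow (p : ℂ[X]) :
    ∃ C : ℝ, 0 ≤ C ∧ ∀ z : ℂ, ‖p.eval z‖ ≤ C * (1 + ‖z‖) ^ p.natDegree := by
  refine ⟨∑ i ∈ Finset.range (p.natDegree + 1), ‖p.coeff i‖,
    Finset.sum_nonneg fun _ _ => norm_nonneg _, fun z => ?_⟩
  rw [Polynomial.eval_eq_sum_range, Finset.sum_mul]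
  refine (norm_sum_le _ _).trans (Finset.sum_le_sum fun i hi => ?_)
  rw [norm_mul, norm_pow]
  have h1 : ‖z‖ ^ i ≤ (1 + ‖z‖) ^ i := by gcongr; linarith
  have h2 : (1 + ‖z‖) ^ i ≤ (1 + ‖z‖) ^ p.natDegree :=
    pow_le_pow_right₀ (by linarith [norm_nonneg z]) (Nat.lt_succ_iff.1 (Finset.mem_range.1 hi))
  exact mul_le_mul_of_nonneg_left (h1.trans h2) (norm_nonneg _)

/-- Liouville's theorem for functions of polynomial growth. -/
theorem exists_polynomial_of_growth (n : ℕ) : ∀ {q : ℂ → ℂ} {C : ℝ}, Differentiable ℂ q →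
    (∀ z, ‖q z‖ ≤ C * (1 + ‖z‖) ^ n) → ∃ P : ℂ[X], ∀ z, q z = P.eval z := by
  induction n with
  | zero =>
    intro q C hq hC
    obtain ⟨k, hk⟩ := hq.exists_const_forall_eq_of_bounded
      ((Metric.isBounded_closedBall (x := (0 : ℂ)) (r := C)).subset (by
        rintro _ ⟨x, rfl⟩
        simpa using hC x))
    exact ⟨Polynomial.C k, fun z => by simp [hk]⟩
  | succ n ih =>
    intro q C hq hC
    have hd : Differentiable ℂ (dslope q 0) := differentiableOn_univ.1
      ((Complex.differentiableOn_dslope univ_mem).2 hq.differentiableOn)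
    have hqd : ∀ z, q z = q 0 + z * dslope q 0 z := fun z => by
      have := sub_smul_dslope q 0 z
      simp only [sub_zero, smul_eq_mul] at this
      rw [this]; ring
    have hC0 : 0 ≤ C := by simpa using (norm_nonneg _).trans (hC 0)
    obtain ⟨B, hB⟩ := (isCompact_closedBall (0 : ℂ) 1).exists_bound_of_continuousOn
      hd.continuous.continuousOn
    have hB0 : 0 ≤ B := (norm_nonneg _).trans (hB 0 (by simp))
    -- `B` handles the unit disk; outside it, dividing by `z` lowers the degree of growth by one.
    obtain ⟨P, hP⟩ := ih (C := B + 4 * C) hd (fun z => by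
      have hpow : 1 ≤ (1 + ‖z‖) ^ n := one_le_pow₀ (by linarith [norm_nonneg z])
      rcases le_total ‖z‖ 1 with hz | hz
      · have := hB z (by simpa using hz)
        nlinarith
      · have h1 : ‖z‖ * ‖dslope q 0 z‖ ≤ ‖q z‖ + ‖q 0‖ := by
          rw [← norm_mul, show z * dslope q 0 z = q z - q 0 by rw [hqd z]; ring]
          exact norm_sub_le _ _
        have h2 : ‖q 0‖ ≤ C := by simpa using hC 0
        have h3 := hC z
        rw [pow_succ] at h3
        set T := (1 + ‖z‖) ^ n
        have hCT : 0 ≤ C * T := mul_nonneg hC0 (by linarith)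
        have h4 : ‖z‖ * ‖dslope q 0 z‖ ≤ ‖z‖ * (4 * (C * T)) := by
          have : C ≤ C * T := le_mul_of_one_le_right hC0 hpow
          nlinarith
        have h5 := le_of_mul_le_mul_left h4 (by linarith)
        nlinarith)
    exact ⟨Polynomial.C (q 0) + Polynomial.X * P, fun z => by simp [hqd z, hP]⟩

/-- The zeros of an entire function at finitely many given points can be divided out. -/
theorem exists_polynomial_mul_of_finset {g : ℂ → ℂ} (hg : Differentiable ℂ g) {a₀ : ℂ}
    (h0 : g a₀ ≠ 0) (s : Finset ℂ) :
    ∃ (p : ℂ[X]) (e : ℂ → ℂ), p ≠ 0 ∧ Differentiable ℂ e ∧ (∀ z, g z = p.eval z * e z) ∧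
      ∀ z ∈ s, e z ≠ 0 := by
  classical
  induction s using Finset.induction_on with
  | empty => exact ⟨1, g, one_ne_zero, hg, by simp, by simp⟩
  | insert a s _ ih =>
    obtain ⟨p, e, hp, he, hpe, hes⟩ := ih
    have hea₀ : e a₀ ≠ 0 := fun h => h0 (by rw [hpe, h, mul_zero])
    have han : AnalyticAt ℂ e a := he.analyticAt a
    have hne : ¬ ∀ᶠ z in 𝓝 a, e z = 0 := fun h => by
      have h1 : AnalyticOnNhd ℂ e univ := fun z _ => he.analyticAt z
      exact hea₀ (h1.eqOn_zero_of_preconnected_of_eventuallyEq_zero isPreconnected_univ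
        (mem_univ a) h (mem_univ a₀))
    obtain ⟨n, h, hh, hha, heq⟩ := han.exists_eventuallyEq_pow_smul_nonzero_iff.2 hne
    set e₁ : ℂ → ℂ := fun z => if z = a then h a else e z / (z - a) ^ n with he₁
    have hoff : ∀ z, z ≠ a → e₁ z = e z / (z - a) ^ n := fun z hz => if_neg hz
    have hmul : ∀ z, e z = (z - a) ^ n * e₁ z := by
      intro z
      by_cases hz : z = a
      · have := heq.self_of_nhds
        simp only [smul_eq_mul] at this
        rw [hz, this, he₁]
        simp
      · rw [hoff z hz, mul_div_cancel₀ _ (pow_ne_zero _ (sub_ne_zero.2 hz))]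
    refine ⟨p * (Polynomial.X - Polynomial.C a) ^ n, e₁,
      mul_ne_zero hp (pow_ne_zero _ (Polynomial.X_sub_C_ne_zero a)), fun z => ?_, fun z => ?_, ?_⟩
    · by_cases hz : z = a
      · have : e₁ =ᶠ[𝓝 z] h := by
          rw [hz]
          filter_upwards [heq] with w hw
          by_cases hwa : w = a
          · rw [hwa, he₁]; simp
          · rw [hoff w hwa, hw, smul_eq_mul,
              mul_div_cancel_left₀ _ (pow_ne_zero _ (sub_ne_zero.2 hwa))]
        exact (hz ▸ hh).differentiableAt.congr_of_eventuallyEq this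
      · have : e₁ =ᶠ[𝓝 z] fun w => e w / (w - a) ^ n := by
          filter_upwards [isOpen_ne.mem_nhds hz] with w hw using hoff w hw
        refine DifferentiableAt.congr_of_eventuallyEq ?_ this
        exact (he z).div (by fun_prop) (pow_ne_zero _ (sub_ne_zero.2 hz))
    · rw [hpe, hmul]
      simp [mul_assoc]
    · intro z hz hz0
      rcases Finset.mem_insert.1 hz with rfl | hz
      · exact hha (by simpa [he₁] using hz0)
      · exact hes z hz (by rw [hmul, hz0, mul_zero])

/-- An entire function that is bounded away from zero near infinity is rational. -/
theorem exists_polynomials_of_isBounded_sublevel {g : ℂ → ℂ} (hg : Differentiable ℂ g) {a₀ : ℂ}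
    (h0 : g a₀ ≠ 0) {B : ℝ} (hB : 0 < B) (hb : Bornology.IsBounded {x | ‖g x‖ ≤ B}) :
    ∃ p q : ℂ[X], p ≠ 0 ∧ ∀ z, p.eval z = q.eval z * g z := by
  have hfin : {x | g x = 0}.Finite := by
    have han : AnalyticOnNhd ℂ g univ := fun z _ => hg.analyticAt z
    have hcpt : IsCompact {x | g x = 0} := Metric.isCompact_of_isClosed_isBounded
      (isClosed_eq hg.continuous continuous_const) (hb.subset fun x (hx : g x = 0) => by
        simp [hx, hB.le])
    by_contra hinf
    obtain ⟨x, -, hx⟩ := Set.Infinite.exists_accPt_of_subset_isCompact hinf hcpt subset_rfl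
    exact h0 (han.eqOn_zero_of_preconnected_of_frequently_eq_zero isPreconnected_univ (mem_univ x)
      (accPt_iff_frequently_nhdsNE.1 hx) (mem_univ a₀))
  obtain ⟨p, e, hp, he, hpe, hes⟩ := exists_polynomial_mul_of_finset hg h0 hfin.toFinset
  have hene : ∀ z, e z ≠ 0 := fun z hz =>
    hes z (by simp [hpe z, hz]) hz
  have hinv : Differentiable ℂ fun z => (e z)⁻¹ := fun z => (he z).inv (hene z)
  obtain ⟨C, hC, hpC⟩ := exists_bound_eval_le_one_add_norm_pow p
  obtain ⟨D, hD⟩ := hb.isCompact_closure.exists_bound_of_continuousOn hinv.continuous.continuousOn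
  -- `D` bounds `1 / e` on the bounded sublevel set; elsewhere `|1 / e| = |p| / |g| < |p| / B` up to
  -- equality at zeros of `p`.
  obtain ⟨q, hq⟩ := exists_polynomial_of_growth p.natDegree (C := max D 0 + C / B) hinv (fun z => by
    have hpow : 1 ≤ (1 + ‖z‖) ^ p.natDegree := one_le_pow₀ (by linarith [norm_nonneg z])
    have hCB : 0 ≤ C / B := by positivity
    have hD0 : 0 ≤ max D 0 := le_max_right _ _
    rw [add_mul]
    by_cases hz : ‖g z‖ ≤ B
    · have h1 : ‖(e z)⁻¹‖ ≤ max D 0 := (hD z (subset_closure hz)).trans (le_max_left _ _)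
      nlinarith [mul_nonneg hCB (zero_le_one.trans hpow)]
    · have hz' : B < ‖g z‖ := not_le.1 hz
      have h1 : ‖p.eval z‖ = ‖g z‖ * ‖(e z)⁻¹‖ := by
        rw [← norm_mul, hpe z, mul_assoc, mul_inv_cancel₀ (hene z), mul_one]
      have h2 : B * ‖(e z)⁻¹‖ ≤ C * (1 + ‖z‖) ^ p.natDegree :=
        (mul_le_mul_of_nonneg_right hz'.le (norm_nonneg _)).trans (h1 ▸ hpC z)
      have h3 : ‖(e z)⁻¹‖ ≤ C / B * (1 + ‖z‖) ^ p.natDegree := by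
        rw [div_mul_eq_mul_div, le_div_iff₀ hB, mul_comm]
        exact h2
      nlinarith [mul_nonneg hD0 (zero_le_one.trans hpow)])
  refine ⟨p, q, hp, fun z => ?_⟩
  rw [← hq, hpe z, mul_comm (p.eval z), inv_mul_cancel_left₀ (hene z)]

/-! ### Passing to the reciprocal -/

/-- The function `1 / (f - b)`, extended by `0` at the poles of `f`. -/
noncomputable def reciprocal (f : ℂ → ℂ) (b z : ℂ) : ℂ :=
  open Classical in if meromorphicOrderAt f z < 0 then 0 else (f z - b)⁻¹

variable {f : ℂ → ℂ} {b z : ℂ}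

theorem reciprocal_of_neg (hz : meromorphicOrderAt f z < 0) : reciprocal f b z = 0 := if_pos hz

theorem reciprocal_of_nonneg (hz : 0 ≤ meromorphicOrderAt f z) :
    reciprocal f b z = (f z - b)⁻¹ := if_neg hz.not_gt

theorem toSphere_of_nonneg (hz : 0 ≤ meromorphicOrderAt f z) :
    toSphere f z = ((f z : ℂ) : OnePoint ℂ) := if_neg hz.not_gt

theorem IsOmittedValue.sub_ne_zero (hb : IsOmittedValue f b) (hz : 0 ≤ meromorphicOrderAt f z) :
    f z - b ≠ 0 := fun h => hb z (by rw [toSphere_of_nonneg hz, sub_eq_zero.1 h])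

theorem reciprocal_eventuallyEq (hz : AnalyticAt ℂ f z) :
    reciprocal f b =ᶠ[𝓝 z] fun w => (f w - b)⁻¹ := by
  filter_upwards [hz.eventually_analyticAt] with w hw
  exact reciprocal_of_nonneg hw.meromorphicOrderAt_nonneg

theorem differentiable_reciprocal (hf : MeromorphicNFOn f univ) (hb : IsOmittedValue f b) :
    Differentiable ℂ (reciprocal f b) := by
  have hreg : ∀ z, AnalyticAt ℂ f z → DifferentiableAt ℂ (reciprocal f b) z := fun z hz =>
    ((hz.differentiableAt.sub_const b).inv
      (hb.sub_ne_zero hz.meromorphicOrderAt_nonneg)).congr_of_eventuallyEq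
      (reciprocal_eventuallyEq hz)
  intro z
  rcases lt_or_ge (meromorphicOrderAt f z) 0 with hz | hz
  · have hev : ∀ᶠ w in 𝓝[≠] z, AnalyticAt ℂ f w :=
      (hf (mem_univ z)).meromorphicAt.eventually_analyticAt
    refine (Complex.analyticAt_of_differentiable_on_punctured_nhds_of_continuousAt
      (hev.mono hreg) ?_).differentiableAt
    rw [continuousAt_iff_punctured_nhds, reciprocal_of_neg hz]
    have h1 : Tendsto (fun w => (f w - b)⁻¹) (𝓝[≠] z) (𝓝 0) := by
      exact tendsto_inv₀_cobounded.comp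
        ((tendsto_sub_const_cobounded b).comp (tendsto_cobounded_of_meromorphicOrderAt_neg hz))
    refine h1.congr' (hev.mono fun w hw => ?_)
    exact (reciprocal_of_nonneg hw.meromorphicOrderAt_nonneg).symm
  · exact hreg z ((hf (mem_univ z)).meromorphicOrderAt_nonneg_iff_analyticAt.1 hz)

theorem preimageDisk_eq {r : ℝ} (hb : IsOmittedValue f b) (hr : 0 < r) :
    preimageDisk f b r = {z | r⁻¹ < ‖reciprocal f b z‖} := by
  ext z
  simp only [preimageDisk, mem_preimage, mem_image, mem_ofPred_eq, Metric.mem_ball, dist_eq_norm]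
  rcases lt_or_ge (meromorphicOrderAt f z) 0 with hz | hz
  · rw [reciprocal_of_neg hz, norm_zero]
    have : toSphere f z = OnePoint.infty := if_pos hz
    simp [this, hr.le]
  · rw [reciprocal_of_nonneg hz, toSphere_of_nonneg hz, norm_inv,
      inv_lt_inv₀ hr (norm_pos_iff.2 (hb.sub_ne_zero hz))]
    simp

theorem frontier_norm_gt {g : ℂ → ℂ} (hg : Differentiable ℂ g) (hnc : ¬ ∃ k, ∀ z, g z = k) (R : ℝ) :
    frontier {z | R < ‖g z‖} = {z | ‖g z‖ = R} := by
  refine Subset.antisymm (fun z hz => ?_) (fun z hz => ?_)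
  · exact (frontier_lt_subset_eq continuous_const hg.continuous.norm hz).symm
  · have hz' : ‖g z‖ = R := hz
    rw [(isOpen_lt continuous_const hg.continuous.norm).frontier_eq]
    -- A point of the level curve not adherent to the superlevel set would be a local maximum of
    -- `|g|`, forcing `g` to be constant.
    refine ⟨not_not.1 fun hcl => ?_, fun h => (h : R < ‖g z‖).ne' hz'⟩
    have hloc : IsLocalMax (norm ∘ g) z := by
      filter_upwards [isClosed_closure.isOpen_compl.mem_nhds hcl] with w hw
      have : ¬ R < ‖g w‖ := fun h => hw (subset_closure h)
      simpa [hz'] using this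
    have hev := Complex.eventually_eq_of_isLocalMax_norm (Eventually.of_forall hg) hloc
    have han : AnalyticOnNhd ℂ g univ := fun w _ => hg.analyticAt w
    exact hnc ⟨g z, fun w => han.eqOn_of_preconnected_of_eventuallyEq
      (fun _ _ => analyticAt_const) isPreconnected_univ (mem_univ z) hev (mem_univ w)⟩

theorem isRational_of_reciprocal {p q : ℂ[X]} (hp : p ≠ 0)
    (hpq : ∀ z, p.eval z = q.eval z * reciprocal f b z) : IsRational f := by
  refine ⟨Polynomial.C b * p + q, p, hp, fun z hz => ?_⟩
  have hg : reciprocal f b z ≠ 0 := fun h => hz (by rw [hpq, h, mul_zero])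
  have hq : q.eval z ≠ 0 := fun h => hz (by rw [hpq, h, zero_mul])
  have hord : 0 ≤ meromorphicOrderAt f z := not_lt.1 fun h => hg (reciprocal_of_neg h)
  rw [reciprocal_of_nonneg hord] at hg
  have hfb : f z - b ≠ 0 := fun h => hg (by rw [h, inv_zero])
  have h1 := hpq z
  rw [reciprocal_of_nonneg hord] at h1
  rw [Polynomial.eval_add, Polynomial.eval_mul, Polynomial.eval_C, eq_div_iff hz, h1]
  field_simp
  ring

theorem exists_reciprocal_ne_zero (hf : IsTranscendentalMeromorphic f) (hb : IsOmittedValue f b) :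
    ∃ z, reciprocal f b z ≠ 0 := by
  by_contra! h
  refine hf.not_rational ⟨0, 1, one_ne_zero, fun z _ => ?_⟩
  -- At a pole the normal form has value 0, so if no point is regular then `f` is identically 0 as a
  -- function.
  rcases meromorphicNFAt_iff_analyticAt_or.1 (hf.meromorphic (mem_univ z)) with hz | ⟨-, -, hz⟩
  · exact absurd ((reciprocal_of_nonneg hz.meromorphicOrderAt_nonneg).symm.trans (h z))
      (inv_ne_zero (hb.sub_ne_zero hz.meromorphicOrderAt_nonneg))
  · simp [hz]

theorem not_const_reciprocal (hf : IsTranscendentalMeromorphic f) (hb : IsOmittedValue f b) :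
    ¬ ∃ k, ∀ z, reciprocal f b z = k := by
  rintro ⟨k, hk⟩
  obtain ⟨z, hz⟩ := exists_reciprocal_ne_zero hf hb
  refine hf.not_rational (isRational_of_reciprocal (b := b) (p := Polynomial.C k) (q := 1) ?_ ?_)
  · exact Polynomial.C_ne_zero.2 (hk z ▸ hz)
  · intro w
    simp [hk w]

theorem exists_critical_point_reciprocal (hf : IsTranscendentalMeromorphic f) (hb : IsBov f b)
    (M : ℝ) : ∃ x, M < ‖reciprocal f b x‖ ∧ deriv (reciprocal f b) x = 0 := by
  obtain ⟨hom, r₀, hr₀, hbd⟩ := hb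
  by_contra! hcrit
  have hg := differentiable_reciprocal hf.meromorphic hom
  have hnc := not_const_reciprocal hf hom
  obtain ⟨a, ha⟩ := exists_reciprocal_ne_zero hf hom
  obtain ⟨B, hB, hBb⟩ := exists_isBounded_sublevel (R₀ := r₀⁻¹) (M := M) hg hnc (by
    intro R hR z hz
    have hR0 : 0 < R := (inv_pos.2 hr₀).trans hR
    have h := hbd R⁻¹ (inv_pos.2 hR0) (inv_lt_of_inv_lt₀ hr₀ hR)
    rw [preimageDisk_eq hom (inv_pos.2 hR0), inv_inv, frontier_norm_gt hg hnc] at h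
    exact h z hz) hcrit
  obtain ⟨p, q, hp, hpq⟩ := exists_polynomials_of_isBounded_sublevel hg ha hB hBb
  exact hf.not_rational (isRational_of_reciprocal hp hpq)

/-- Nonvanishing of `1 / (f - b)` excludes poles, and at regular points its derivative is `-f' / (f
- b)²`. -/
theorem mem_criticalPoints_of_reciprocal (hf : MeromorphicNFOn f univ) (hb : IsOmittedValue f b)
    (hz : reciprocal f b z ≠ 0) (hd : deriv (reciprocal f b) z = 0) :
    0 ≤ meromorphicOrderAt f z ∧ z ∈ criticalPoints f := by
  have hord : 0 ≤ meromorphicOrderAt f z := not_lt.1 fun h => hz (reciprocal_of_neg h)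
  have han := (hf (mem_univ z)).meromorphicOrderAt_nonneg_iff_analyticAt.1 hord
  refine ⟨hord, Or.inl ⟨hord, ?_⟩⟩
  have hne := hb.sub_ne_zero hord
  rw [(reciprocal_eventuallyEq han).deriv_eq,
    ((han.differentiableAt.hasDerivAt.sub_const b).fun_inv hne).deriv] at hd
  simpa [hne] using hd

theorem accPt_criticalValues (hf : IsTranscendentalMeromorphic f) (hb : IsBov f b) :
    AccPt (b : OnePoint ℂ) (𝓟 (criticalValues f)) := by
  rw [accPt_iff_nhds]
  intro U hU
  have hU' : ((↑) : ℂ → OnePoint ℂ) ⁻¹' U ∈ 𝓝 b :=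
    OnePoint.continuous_coe.continuousAt.preimage_mem_nhds hU
  obtain ⟨ε, hε, hball⟩ := Metric.mem_nhds_iff.1 hU'
  obtain ⟨x, hx, hdx⟩ := exists_critical_point_reciprocal hf hb ε⁻¹
  have hx0 : reciprocal f b x ≠ 0 := norm_pos_iff.1 ((inv_pos.2 hε).trans hx)
  obtain ⟨hord, hcrit⟩ := mem_criticalPoints_of_reciprocal hf.meromorphic hb.1 hx0 hdx
  have hval : toSphere f x ∈ (fun w : ℂ => (w : OnePoint ℂ)) '' Metric.ball b ε := by
    have : x ∈ preimageDisk f b ε := by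
      rw [preimageDisk_eq hb.1 hε]
      exact hx
    exact this
  obtain ⟨w, hw, hwx⟩ := hval
  exact ⟨toSphere f x, ⟨hwx ▸ hball hw, x, hcrit, rfl⟩, hb.1 x⟩

end BakerOmitted

theorem mainTheorem6 (f : ℂ → ℂ) (hf : BakerOmitted.IsTranscendentalMeromorphic f)
    (b : ℂ) (hb : BakerOmitted.IsBov f b) :
    AccPt (b : OnePoint ℂ) (Filter.principal (BakerOmitted.criticalValues f)) ∧
      (BakerOmitted.singularValues f).Infinite := by
  have h := BakerOmitted.accPt_criticalValues hf hb
  exact ⟨h, (Set.Infinite.of_accPt h).mono (subset_union_left.trans subset_closure)⟩
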